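/- Let $d$ be a prime and $n\ge 0$, let $\omega=\exp(2\pi i/d)$, $\tau=(-1)^d\exp(i\pi/d)$ (so $\tau^2=\omega$), and let $\mathcal X=\mathbb Z_d^n$ label the standard basis of $(\mathbb C^d)^{\otimes n}$. The Clifford group $\mathrm{Cl}$ is the subgroup of the unitary group of $(\mathbb C^d)^{\otimes n}$ generated by - the Fourier gate $\gamma_d\, d^{-1/2}\sum_{x,y\in\mathbb Z_d}\omega^{xy}|x\rangle\langle y|$ on any qudit, where $\gamma_2=1$ and, for odd $d$, $\gamma_d=d^{-1/2}\sum_{z\in\mathbb Z_d}\tau^{z^2}$; - the phase gate on any qudit, i.e. $\sum_x\tau^{x^2}|x\rangle\langle x|$ if $d=2$ and $\sum_x\tau^{x(x-1)}|x\rangle\langle x|$ if $d$ is odd; - the gate $\mathrm{CADD}=\sum_{x,y}|x,x+y\rangle\langle x,y|$ on any ordered pair of distinct qudits. (The phase $\gamma_d$ is chosen so that, for odd $d$ and $n\ge1$, the center of $\mathrm{Cl}$ is $\langle\omega\mathbb 1\rangle$ and $\mathrm{Cl}$ is the semidirect product of the Pauli group and $\mathrm{Sp}(2n,d)$.) For a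 quadratic form $q$ on $\mathcal X$ let $U_q=\sum_{x\in\mathcal X}\omega^{q(x)}|x\rangle\langle x|\in\mathrm{Cl}$. Let $\rho$ be a finite-dimensional complex representation of $\mathrm{Cl}$. A symmetric matrix $B\in\mathbb Z_d^{n\times n}$ is a weight of $\rho$ if there is a vector $\psi\neq0$ such that $\rho(U_q)\psi=\omega^{\mathrm{tr}(MB)}\psi$ for all quadratic forms $q$ and all matrices $M\in\mathbb Z_d^{n\times n}$ with $q(x)=x^TMx$ for every $x\in\mathcal X$. The rank of $\rho$ is $\mathrm{rk}(\rho)=\max\{\mathrm{rank}\,B : B\text{ is a weight of }\rho\}$. **Lemma.** 1. If $d$ is odd, the trivial representation is, up to isomorphism, the unique irreducible representation of $\mathrm{Cl}$ of rank zero. 2. If $d=2$ and $n\ge3$, every irreducible representation $\rho$ of $\mathrm{Cl}$ of rank zero is one-dimensional and satisfies $\rho(g)=\pm1$ for all $g\in\mathrm{Cl}$. Moreover, with $\omega_8=\exp(2\pi i/8)$, the matrix $\omega_8\mathbb 1$ is a central element of $\mathrm{Cl}$, and if $\rho,\rho'$ are irreducible representations of rank zero such that $\rho(\omega_8\mathbb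 1)$ and $\rho'(\omega_8\mathbb 1)$ are the same scalar, then $\rho\simeq\rho'$. -/

import Mathlib

namespace CliffordRank

open scoped Matrix

/-- The index set `𝒳 = ℤ_d^n` of the standard basis of `(ℂ^d)^{⊗ n}`. Operators on this space
are complex matrices indexed by `𝒳`. -/
abbrev Conf (d n : ℕ) : Type := Fin n → ZMod d

/-- `τ = (-1)^d exp(iπ/d)`, a square root of `ω = exp(2πi/d)`. -/
noncomputable def tau (d : ℕ) : ℂ :=
  (-1) ^ d * Complex.exp (Complex.I * (Real.pi : ℂ) / (d : ℂ))

/-- `ω^a = exp(2πi a/d)` for `a ∈ ℤ_d`. -/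
noncomputable def omegaPow (d : ℕ) [NeZero d] (a : ZMod d) : ℂ :=
  Complex.exp (2 * (Real.pi : ℂ) * Complex.I * (a.val : ℂ) / (d : ℂ))

/-- The phase in front of the discrete Fourier transform. For even `d` it is `1`; for odd `d` it
is the normalized quadratic Gauss sum `d^{-1/2} ∑_z τ^{z²}`, a fourth root of unity. With this
phase the Fourier transform lies in the oscillator representation of the symplectic group, so
that for odd primes `d` the Clifford group is the semidirect product of the Pauli group and
`Sp(2n, d)`, with center `⟨ω 1⟩`. (For `d ≡ 1 mod 8` prime the phase is `1`.) -/
noncomputable def fourierPhase (d : ℕ) [NeZero d] : ℂ :=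
  if Even d then 1 else (∑ z : ZMod d, tau d ^ (z.val ^ 2)) / (Real.sqrt d : ℂ)

/-- The discrete Fourier transform (for `d = 2`: the Hadamard gate) on qudit `i`. -/
noncomputable def fourierGate (d n : ℕ) [NeZero d] (i : Fin n) :
    Matrix (Conf d n) (Conf d n) ℂ :=
  Matrix.of fun x y =>
    if ∀ j, j ≠ i → x j = y j then
      fourierPhase d * (1 / (Real.sqrt d : ℂ)) * omegaPow d (x i * y i)
    else 0

/-- The phase gate on qudit `i`. -/
noncomputable def phaseGate (d n : ℕ) [NeZero d] (i : Fin n) :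
    Matrix (Conf d n) (Conf d n) ℂ :=
  Matrix.diagonal fun x =>
    if Even d then tau d ^ ((x i).val ^ 2) else tau d ^ ((x i).val * ((x i).val - 1))

/-- Controlled addition with control qudit `i` and target qudit `j`: `|y⟩ ↦ |y + y_i e_j⟩`. -/
def caddGate (d n : ℕ) [NeZero d] (i j : Fin n) : Matrix (Conf d n) (Conf d n) ℂ :=
  Matrix.of fun x y => if x = Function.update y j (y j + y i) then 1 else 0

/-- The `n`-qudit Clifford group: the subgroup of the unitary group of `(ℂ^d)^{⊗ n}` generated
by the Fourier, phase and controlled addition gates. -/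
noncomputable def cliffordGroup (d n : ℕ) [NeZero d] :
    Subgroup (Matrix.unitaryGroup (Conf d n) ℂ) :=
  Subgroup.closure
    {U | (∃ i, (U : Matrix (Conf d n) (Conf d n) ℂ) = fourierGate d n i) ∨
      (∃ i, (U : Matrix (Conf d n) (Conf d n) ℂ) = phaseGate d n i) ∨
      (∃ i j, i ≠ j ∧ (U : Matrix (Conf d n) (Conf d n) ℂ) = caddGate d n i j)}

/-- The matrix of an element of the Clifford group. -/
def toMat {d n : ℕ} [NeZero d] (g : cliffordGroup d n) : Matrix (Conf d n) (Conf d n) ℂ :=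
  ((g : Matrix.unitaryGroup (Conf d n) ℂ) : Matrix (Conf d n) (Conf d n) ℂ)

/-- The diagonal matrix `U_q = ∑_x ω^{q(x)} |x⟩⟨x|` of a quadratic form `q` on `ℤ_d^n`. -/
noncomputable def diagQuad {d n : ℕ} [NeZero d] (q : QuadraticForm (ZMod d) (Conf d n)) :
    Matrix (Conf d n) (Conf d n) ℂ :=
  Matrix.diagonal fun x => omegaPow d (q x)

section Rank

variable {d n : ℕ} [NeZero d] {V : Type*} [AddCommGroup V] [Module ℂ V]

/-- `ψ` is a weight vector of `ρ` with weight the symmetric matrix `B`: it is a common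
eigenvector of all `ρ(U_q)`, with eigenvalue `ω^{(B, q)}`, where `(B, q) = tr(M B)` for any
matrix representation `M` of `q`, i.e. `q(x) = xᵀ M x`. -/
def IsWeightVector (ρ : Representation ℂ (cliffordGroup d n) V)
    (B : Matrix (Fin n) (Fin n) (ZMod d)) (ψ : V) : Prop :=
  B.IsSymm ∧ ψ ≠ 0 ∧
    ∀ (q : QuadraticForm (ZMod d) (Conf d n)) (M : Matrix (Fin n) (Fin n) (ZMod d)),
      (∀ x, q x = x ⬝ᵥ M *ᵥ x) →
        ∀ g : cliffordGroup d n, toMat g = diagQuad q →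
          ρ g ψ = omegaPow d (M * B).trace • ψ

/-- `B` is a weight of `ρ`. -/
def IsWeight (ρ : Representation ℂ (cliffordGroup d n) V)
    (B : Matrix (Fin n) (Fin n) (ZMod d)) : Prop :=
  ∃ ψ : V, IsWeightVector ρ B ψ

/-- The rank of a representation of the Clifford group: the maximal rank of its weights. -/
noncomputable def rk (ρ : Representation ℂ (cliffordGroup d n) V) : ℕ :=
  sSup {r | ∃ B, IsWeight ρ B ∧ B.rank = r}

end Rank

/-- `ω_8 = exp(2πi/8)`. -/
noncomputable def omega8 : ℂ := Complex.exp (2 * (Real.pi : ℂ) * Complex.I / 8)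

end CliffordRank

/-!
A representation `ρ` of rank zero is trivial on every diagonal gate `U_q`. Indeed the `ρ(U_q)` form
a representation of the finite abelian group of quadratic forms, whose characters are all of the
form `q ↦ ω^{tr(M B)}` with `B` symmetric, and a matrix of rank zero is zero; see
`apply_eq_one_of_rk_eq_zero`. The statement is therefore about the quotient of the Clifford group
by the normal closure of the `U_q`, and this quotient can be read off from a few relations between
the generators. Write `F`, `S` for the Fourier and phase gates and `≡` for equality in the quotient.

In all cases `CADD_ij` is conjugate by `F_j` to the diagonal gate of `-x_i x_j`, so `CADD ≡ 1`.

For odd `d` the quotient is trivial (`map_eq_one_of_odd`). With `Q = U_{x²/2}` one has the exact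
relation `F Q⁻¹ F = Q F Q`: completing the square produces a Gauss sum, which the phase `γ_d`
cancels. Hence `F² ≡ F`, i.e. `F ≡ 1`. As `F²` is the parity operator up to a phase,
`S F² S = U_{x²} F²`, so `S² ≡ 1`, and `S ≡ 1` because `S ^ d = 1` with `d` odd.

For `d = 2` and at least two qubits the quotient has order at most two and is generated by `ω_8`
(`map_eq_one_or_eq_of_two`). The relation `S_i S_j CADD_ij = CZ_ij CADD_ij S_j` gives `S ≡ 1`, and
then `(F S)³ = ω_8` and `F² = 1` give `F ≡ ω_8` on every qubit. Since `ω_8 1` is central, Schur's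
lemma makes it act on an irreducible representation by a scalar, necessarily `±1`, and this scalar
determines the representation.
-/

namespace CliffordRank

open scoped Matrix
open ZMod (stdAddChar)

/-! ### Phases and Gauss sums -/

section Phases

variable {d : ℕ}

lemma tau_mul_star_tau : tau d * star (tau d) = 1 := by
  have h : ‖tau d‖ = 1 := by
    rw [tau, norm_mul, norm_pow, norm_neg, norm_one, one_pow, one_mul]
    have : Complex.I * (Real.pi : ℂ) / (d : ℂ) = ((Real.pi / d : ℝ) : ℂ) * Complex.I := by
      push_cast; ring
    rw [this, Complex.norm_exp_ofReal_mul_I]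
  rw [Complex.star_def, Complex.mul_conj, Complex.normSq_eq_norm_sq, h]
  simp

lemma sqrt_mul_sqrt : (Real.sqrt d : ℂ) * (Real.sqrt d : ℂ) = d := by
  rw [← Complex.ofReal_mul, Real.mul_self_sqrt (Nat.cast_nonneg d)]
  simp

variable [NeZero d]

lemma omegaPow_eq_stdAddChar (a : ZMod d) : omegaPow d a = stdAddChar a := by
  rw [ZMod.stdAddChar_apply, ZMod.toCircle_apply, omegaPow]

lemma star_stdAddChar (a : ZMod d) : star (stdAddChar a) = stdAddChar (-a) :=
  (AddChar.map_neg_eq_conj _ a).symm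

lemma sum_stdAddChar_mul (b : ZMod d) :
    ∑ x : ZMod d, stdAddChar (x * b) = if b = 0 then (d : ℂ) else 0 := by
  rw [AddChar.sum_mulShift b (ZMod.isPrimitive_stdAddChar d)]
  simp [ZMod.card]

/-- The inverse of `2` in `ℤ_d` for odd `d`. -/
def half (d : ℕ) : ZMod d := ((d + 1) / 2 : ℕ)

lemma half_add_half (hd : Odd d) : half d + half d = 1 := by
  obtain ⟨k, rfl⟩ := hd
  have h : (2 * k + 1 + 1) / 2 = k + 1 := by omega
  rw [half, h, ← Nat.cast_add, show k + 1 + (k + 1) = (2 * k + 1) + 1 by ring, Nat.cast_add,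
    ZMod.natCast_self]
  simp

/-- For odd `d` the square root `τ` of `ω` is itself a power of `ω`, namely `ω^{1/2}`. -/
lemma tau_pow (hd : Odd d) (m : ℕ) : tau d ^ m = stdAddChar (half d * (m : ZMod d)) := by
  have h1 : tau d = stdAddChar (half d) := by
    have h := ZMod.stdAddChar_coe (N := d) (((d + 1) / 2 : ℕ) : ℤ)
    rw [Int.cast_natCast] at h
    rw [half, h, tau, hd.neg_one_pow]
    obtain ⟨k, rfl⟩ := hd
    have h2 : (2 * k + 1 + 1) / 2 = k + 1 := by omega
    rw [h2]
    have hne : ((2 * k + 1 : ℕ) : ℂ) ≠ 0 := Nat.cast_ne_zero.mpr (Nat.succ_ne_zero _)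
    rw [← Complex.exp_pi_mul_I, ← Complex.exp_add]
    congr 1
    field_simp
    push_cast
    ring
  rw [h1, ← AddChar.map_nsmul_eq_pow, nsmul_eq_mul, mul_comm]

lemma tau_two : tau 2 = Complex.I := by
  rw [tau]
  have : Complex.I * (Real.pi : ℂ) / ((2 : ℕ) : ℂ) = Real.pi / 2 * Complex.I := by
    push_cast; ring
  rw [this, Complex.exp_pi_div_two_mul_I]
  simp

variable (d) in
/-- The quadratic Gauss sum `∑_z ω^{z²/2}`. -/
noncomputable def quadGauss : ℂ := ∑ z : ZMod d, stdAddChar (half d * z ^ 2)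

/-- `|∑_z ω^{z²/2}|² = d`: after the substitution `z = u + w` in the double sum over `z` and `w`, the
exponent `(z² - w²)/2 = u²/2 + wu` is linear in `w`. -/
lemma quadGauss_mul_star (hd : Odd d) : quadGauss d * star (quadGauss d) = d := by
  have key : ∀ w u : ZMod d, stdAddChar (half d * (u + w) ^ 2) * stdAddChar (-(half d * w ^ 2))
      = stdAddChar (half d * u ^ 2) * stdAddChar (w * u) := by
    intro w u
    rw [← AddChar.map_add_eq_mul, ← AddChar.map_add_eq_mul]
    congr 1
    linear_combination w * u * half_add_half hd
  calc quadGauss d * star (quadGauss d)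
      = ∑ w : ZMod d, ∑ z : ZMod d,
          stdAddChar (half d * z ^ 2) * stdAddChar (-(half d * w ^ 2)) := by
        simp only [quadGauss, star_sum, star_stdAddChar]
        rw [Finset.sum_mul_sum, Finset.sum_comm]
    _ = ∑ w : ZMod d, ∑ u : ZMod d, stdAddChar (half d * u ^ 2) * stdAddChar (w * u) := by
        refine Finset.sum_congr rfl fun w _ => ?_
        rw [← Equiv.sum_comp (Equiv.addRight w)]
        exact Finset.sum_congr rfl fun u _ => key w u
    _ = ∑ u : ZMod d, stdAddChar (half d * u ^ 2) * if u = 0 then (d : ℂ) else 0 := by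
        rw [Finset.sum_comm]
        refine Finset.sum_congr rfl fun u _ => ?_
        rw [← Finset.mul_sum, sum_stdAddChar_mul]
    _ = d := by simp

lemma sqrt_ne_zero : (Real.sqrt d : ℂ) ≠ 0 := by
  intro h
  have := sqrt_mul_sqrt (d := d)
  rw [h, mul_zero] at this
  exact NeZero.ne d (by exact_mod_cast this.symm)

lemma fourierPhase_of_odd (hd : Odd d) : fourierPhase d = quadGauss d / (Real.sqrt d : ℂ) := by
  rw [fourierPhase, if_neg (Nat.not_even_iff_odd.mpr hd), quadGauss]
  congr 1
  refine Finset.sum_congr rfl fun z _ => ?_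
  rw [tau_pow hd]
  simp

lemma fourierPhase_mul_star : fourierPhase d * star (fourierPhase d) = 1 := by
  rcases Nat.even_or_odd d with hd | hd
  · simp [fourierPhase, hd]
  · have hs : star (Real.sqrt d : ℂ) = (Real.sqrt d : ℂ) := Complex.conj_ofReal _
    rw [fourierPhase_of_odd hd, star_div₀, hs, div_mul_div_comm, quadGauss_mul_star hd,
      sqrt_mul_sqrt, div_self (NeZero.ne _)]

end Phases

/-! ### One-qudit gates -/

section OneQudit

/-- The diagonal entries of the phase gate of a single qudit. -/
noncomputable def phaseFun (d : ℕ) (x : ZMod d) : ℂ :=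
  if Even d then tau d ^ (x.val ^ 2) else tau d ^ (x.val * (x.val - 1))

lemma phaseFun_mul_star {d : ℕ} (x : ZMod d) : phaseFun d x * star (phaseFun d x) = 1 := by
  rw [phaseFun]
  split_ifs <;> rw [star_pow, ← mul_pow, tau_mul_star_tau, one_pow]

variable (d : ℕ) [NeZero d]

/-- The Fourier gate of a single qudit. -/
noncomputable def fourierMat : Matrix (ZMod d) (ZMod d) ℂ :=
  Matrix.of fun x y => fourierPhase d * (1 / (Real.sqrt d : ℂ)) * stdAddChar (x * y)

variable {d}

lemma phaseFun_of_odd (hd : Odd d) (x : ZMod d) :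
    phaseFun d x = stdAddChar (half d * (x * (x - 1))) := by
  rw [phaseFun, if_neg (Nat.not_even_iff_odd.mpr hd), tau_pow hd]
  congr 2
  -- the truncated subtraction `x.val - 1` is off only at `x.val = 0`, where the product vanishes
  rcases Nat.eq_zero_or_pos x.val with h | h
  · have : x = 0 := (ZMod.val_eq_zero x).mp h
    simp [this]
  · rw [Nat.cast_mul, Nat.cast_sub h]
    simp

lemma fourierMat_mul_star : fourierMat d * star (fourierMat d) = 1 := by
  have hs : star (Real.sqrt d : ℂ) = (Real.sqrt d : ℂ) := Complex.conj_ofReal _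
  ext x y
  rw [Matrix.mul_apply]
  have key : ∀ z, fourierMat d x z * star (fourierMat d) z y
      = 1 / (d : ℂ) * stdAddChar (z * (x - y)) := by
    intro z
    rw [Matrix.star_apply, fourierMat, Matrix.of_apply, Matrix.of_apply, star_mul', star_mul',
      star_stdAddChar, star_div₀, star_one, hs]
    calc _ = (fourierPhase d * star (fourierPhase d)) * (1 / ((Real.sqrt d : ℂ) * Real.sqrt d))
          * (stdAddChar (x * z) * stdAddChar (-(y * z))) := by ring
      _ = _ := by
        rw [fourierPhase_mul_star, sqrt_mul_sqrt, ← AddChar.map_add_eq_mul, one_mul]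
        congr 2; ring
  rw [Finset.sum_congr rfl fun z _ => key z, ← Finset.mul_sum, sum_stdAddChar_mul,
    Matrix.one_apply]
  simp only [sub_eq_zero]
  split_ifs
  · exact one_div_mul_cancel (NeZero.ne _)
  · simp

/-- The square of the Fourier transform is, up to a phase, the parity operator `|x⟩ ↦ |-x⟩`. -/
lemma fourierMat_mul_self_apply (x y : ZMod d) :
    (fourierMat d * fourierMat d) x y = if x + y = 0 then fourierPhase d ^ 2 else 0 := by
  rw [Matrix.mul_apply]
  have key : ∀ z, fourierMat d x z * fourierMat d z y
      = fourierPhase d ^ 2 * (1 / (d : ℂ)) * stdAddChar (z * (x + y)) := by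
    intro z
    rw [fourierMat, Matrix.of_apply, Matrix.of_apply, mul_add, AddChar.map_add_eq_mul,
      mul_comm z x, ← sqrt_mul_sqrt (d := d)]
    ring
  rw [Finset.sum_congr rfl fun z _ => key z, ← Finset.mul_sum, sum_stdAddChar_mul]
  split_ifs
  · rw [mul_assoc, one_div_mul_cancel (NeZero.ne _), mul_one]
  · simp

/-- Conjugating the phase gate by the parity operator and multiplying by the phase gate cancels
the linear terms of the exponents `x(x ∓ 1)/2` and leaves `ω^{x²}`. -/
lemma phase_fourier_sq_phase (hd : Odd d) :
    Matrix.diagonal (phaseFun d) * (fourierMat d * fourierMat d) * Matrix.diagonal (phaseFun d) =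
      Matrix.diagonal (fun x => stdAddChar (x ^ 2)) * (fourierMat d * fourierMat d) := by
  ext x y
  rw [Matrix.mul_diagonal, Matrix.diagonal_mul, Matrix.diagonal_mul, fourierMat_mul_self_apply]
  split_ifs with h
  · obtain rfl : y = -x := (neg_eq_of_add_eq_zero_right h).symm
    rw [phaseFun_of_odd hd, phaseFun_of_odd hd, mul_right_comm, ← AddChar.map_add_eq_mul]
    congr 2
    linear_combination x ^ 2 * half_add_half hd
  · simp

/-- The exact form of the factorization of the Fourier transform into unipotent factors. The phase
`γ_d` of the Fourier gate is what makes it hold without a scalar. -/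
lemma fourier_quad_fourier (hd : Odd d) :
    fourierMat d * Matrix.diagonal (fun x => stdAddChar (-half d * x ^ 2)) * fourierMat d =
      Matrix.diagonal (fun x => stdAddChar (half d * x ^ 2)) * fourierMat d *
        Matrix.diagonal (fun x => stdAddChar (half d * x ^ 2)) := by
  have hs : star (Real.sqrt d : ℂ) = (Real.sqrt d : ℂ) := Complex.conj_ofReal _
  ext x y
  rw [Matrix.mul_apply, Matrix.mul_diagonal, Matrix.diagonal_mul]
  simp only [Matrix.mul_diagonal]
  have key : ∀ z, fourierMat d x z * stdAddChar (-half d * z ^ 2) * fourierMat d z y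
      = fourierPhase d ^ 2 * (1 / (d : ℂ)) * stdAddChar (half d * (x + y) ^ 2)
        * stdAddChar (-(half d * (z - (x + y)) ^ 2)) := by
    intro z
    calc _ = fourierPhase d ^ 2 * (1 / ((Real.sqrt d : ℂ) * Real.sqrt d)) *
          (stdAddChar (x * z) * stdAddChar (-half d * z ^ 2) * stdAddChar (z * y)) := by
          rw [fourierMat, Matrix.of_apply, Matrix.of_apply]; ring
      _ = _ := by
          rw [sqrt_mul_sqrt, mul_assoc (fourierPhase d ^ 2 * (1 / (d : ℂ))),
            ← AddChar.map_add_eq_mul, ← AddChar.map_add_eq_mul, ← AddChar.map_add_eq_mul]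
          congr 2
          linear_combination -(z * (x + y)) * half_add_half hd
  have hgauss : ∑ z : ZMod d, stdAddChar (-(half d * (z - (x + y)) ^ 2))
      = star (quadGauss d) := by
    rw [quadGauss, star_sum, ← Equiv.sum_comp (Equiv.addRight (x + y))]
    exact Finset.sum_congr rfl fun z _ => by
      rw [Equiv.coe_addRight, add_sub_cancel_right, star_stdAddChar]
  rw [Finset.sum_congr rfl fun z _ => key z, ← Finset.mul_sum, hgauss]
  have h1 : star (quadGauss d) = star (fourierPhase d) * (Real.sqrt d : ℂ) := by
    rw [fourierPhase_of_odd hd, star_div₀, hs, div_mul_cancel₀ _ sqrt_ne_zero]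
  have h2 : stdAddChar (half d * (x + y) ^ 2)
      = stdAddChar (half d * x ^ 2) * stdAddChar (x * y) * stdAddChar (half d * y ^ 2) := by
    rw [← AddChar.map_add_eq_mul, ← AddChar.map_add_eq_mul]
    congr 1
    linear_combination (x * y) * half_add_half hd
  rw [h1, h2, fourierMat, Matrix.of_apply, ← sqrt_mul_sqrt (d := d)]
  have h3 := sqrt_ne_zero (d := d)
  field_simp
  linear_combination (fourierPhase d * stdAddChar (half d * x ^ 2) * stdAddChar (x * y)
    * stdAddChar (half d * y ^ 2)) * fourierPhase_mul_star (d := d)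

end OneQudit

/-! ### Gates acting on one qudit of several -/

section Local

variable {d n : ℕ}

/-- The operator on `n` qudits that acts as `A` on qudit `i` and trivially on the others. -/
def onQudit (i : Fin n) (A : Matrix (ZMod d) (ZMod d) ℂ) : Matrix (Conf d n) (Conf d n) ℂ :=
  Matrix.of fun x y => if ∀ j, j ≠ i → x j = y j then A (x i) (y i) else 0

lemma onQudit_diagonal (i : Fin n) (f : ZMod d → ℂ) :
    onQudit i (Matrix.diagonal f) = Matrix.diagonal fun x : Conf d n => f (x i) := by
  ext x y
  by_cases h : x = y
  · subst h; simp [onQudit]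
  · rw [Matrix.diagonal_apply_ne _ h, onQudit, Matrix.of_apply]
    split_ifs with h1
    · refine Matrix.diagonal_apply_ne _ fun h2 => h (funext fun j => ?_)
      by_cases hj : j = i
      · rw [hj, h2]
      · exact h1 j hj
    · rfl

lemma star_onQudit (i : Fin n) (A : Matrix (ZMod d) (ZMod d) ℂ) :
    star (onQudit i A) = onQudit i (star A) := by
  ext x y
  rw [Matrix.star_apply]
  simp only [onQudit, Matrix.of_apply, Matrix.star_apply]
  have : (∀ j, j ≠ i → y j = x j) ↔ ∀ j, j ≠ i → x j = y j :=
    forall₂_congr fun j _ => eq_comm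
  simp only [this]
  split_ifs <;> simp

lemma onQudit_smul_one (i : Fin n) (c : ℂ) :
    onQudit i (c • (1 : Matrix (ZMod d) (ZMod d) ℂ)) = c • 1 := by
  rw [← Matrix.diagonal_one, ← Matrix.diagonal_smul, onQudit_diagonal, ← Matrix.diagonal_one,
    ← Matrix.diagonal_smul]
  rfl

lemma onQudit_one (i : Fin n) : onQudit i (1 : Matrix (ZMod d) (ZMod d) ℂ) = 1 := by
  simpa using onQudit_smul_one (d := d) i 1

variable [NeZero d]

lemma onQudit_mul_apply (i : Fin n) (A : Matrix (ZMod d) (ZMod d) ℂ)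
    (M : Matrix (Conf d n) (Conf d n) ℂ) (x y : Conf d n) :
    (onQudit i A * M) x y = ∑ a, A (x i) a * M (Function.update x i a) y := by
  rw [Matrix.mul_apply]
  symm
  refine Finset.sum_of_injOn (fun a => Function.update x i a)
    (fun a _ b _ h => Function.update_injective x i h) 
    (fun _ _ => Finset.mem_coe.2 (Finset.mem_univ _)) ?_ ?_
  · intro z _ hz
    have : ¬ ∀ j, j ≠ i → x j = z j := by
      intro h
      refine hz ⟨z i, by simp, ?_⟩
      ext j
      by_cases hj : j = i
      · subst hj; simp
      · simp [hj, h j hj]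
    simp [onQudit, this]
  · intro a _
    have : ∀ j, j ≠ i → x j = Function.update x i a j := fun j hj => by simp [hj]
    rw [onQudit, Matrix.of_apply, if_pos this, Function.update_self]

lemma onQudit_mul (i : Fin n) (A B : Matrix (ZMod d) (ZMod d) ℂ) :
    onQudit i A * onQudit i B = onQudit i (A * B) := by
  ext x y
  rw [onQudit_mul_apply]
  have h : ∀ a, (∀ j, j ≠ i → Function.update x i a j = y j) ↔ ∀ j, j ≠ i → x j = y j :=
    fun a => forall₂_congr fun j hj => by simp [hj]
  simp only [onQudit, Matrix.of_apply, h, Function.update_self, Matrix.mul_apply]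
  split_ifs <;> simp

lemma fourierGate_eq (i : Fin n) : fourierGate d n i = onQudit i (fourierMat d) := by
  ext x y
  simp only [fourierGate, onQudit, fourierMat, Matrix.of_apply, omegaPow_eq_stdAddChar]

lemma phaseGate_eq (i : Fin n) :
    phaseGate d n i = onQudit i (Matrix.diagonal (phaseFun d)) := by
  rw [onQudit_diagonal]
  rfl

end Local

/-! ### Controlled addition -/

section Cadd

variable {d n : ℕ} [NeZero d]

lemma caddGate_mul_apply {i j : Fin n} (hij : i ≠ j) (M : Matrix (Conf d n) (Conf d n) ℂ)
    (x y : Conf d n) :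
    (caddGate d n i j * M) x y = M (Function.update x j (x j - x i)) y := by
  rw [Matrix.mul_apply, Finset.sum_eq_single (Function.update x j (x j - x i))]
  · simp [caddGate, hij]
  · intro z _ hz
    rw [caddGate, Matrix.of_apply, if_neg, zero_mul]
    rintro rfl
    exact hz (by simp [hij])
  · simp

lemma caddGate_mul_star {i j : Fin n} (hij : i ≠ j) :
    caddGate d n i j * star (caddGate d n i j) = 1 := by
  ext x y
  rw [caddGate_mul_apply hij, Matrix.star_apply, caddGate, Matrix.of_apply, Matrix.one_apply]
  simp only [Function.update_self, Function.update_of_ne hij, sub_add_cancel,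
    Function.update_idem, Function.update_eq_self, eq_comm (a := y)]
  split_ifs <;> simp

/-- Controlled addition is conjugate, by a Fourier transform of the target qudit, to the diagonal
gate of the quadratic form `-x_i x_j`. -/
lemma caddGate_mul_fourierGate {i j : Fin n} (hij : i ≠ j) :
    caddGate d n i j * fourierGate d n j =
      fourierGate d n j * Matrix.diagonal fun x => stdAddChar (-(x i * x j)) := by
  ext x y
  rw [caddGate_mul_apply hij, Matrix.mul_diagonal, fourierGate_eq, onQudit, Matrix.of_apply,
    Matrix.of_apply]
  have h : (∀ k, k ≠ j → Function.update x j (x j - x i) k = y k) ↔ ∀ k, k ≠ j → x k = y k :=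
    forall₂_congr fun k hk => by simp [hk]
  simp only [h, Function.update_self]
  split_ifs with h1
  · rw [← h1 i hij, fourierMat, Matrix.of_apply, Matrix.of_apply,
      mul_assoc (_ * _) (stdAddChar _), ← AddChar.map_add_eq_mul]
    congr 2
    ring
  · simp

end Cadd

/-! ### Elements of the Clifford group -/

section Elements

variable {d n : ℕ} [NeZero d]

lemma toMat_injective : Function.Injective (toMat : cliffordGroup d n → _) :=
  Subtype.val_injective.comp Subtype.val_injective

lemma toMat_mul (g h : cliffordGroup d n) : toMat (g * h) = toMat g * toMat h := rfl

lemma toMat_one : toMat (1 : cliffordGroup d n) = 1 := rfl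

lemma toMat_inv (g : cliffordGroup d n) : toMat g⁻¹ = star (toMat g) := rfl

lemma toMat_mul_star (g : cliffordGroup d n) : toMat g * star (toMat g) = 1 :=
  Matrix.mem_unitaryGroup_iff.mp g.1.2

/-- The Fourier gate on qudit `i` as an element of the Clifford group. -/
noncomputable def fourierElt (d : ℕ) {n : ℕ} [NeZero d] (i : Fin n) : cliffordGroup d n :=
  ⟨⟨fourierGate d n i, Matrix.mem_unitaryGroup_iff.mpr (by
    rw [fourierGate_eq, star_onQudit, onQudit_mul, fourierMat_mul_star, onQudit_one])⟩,
    Subgroup.subset_closure (Or.inl ⟨i, rfl⟩)⟩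

/-- The phase gate on qudit `i` as an element of the Clifford group. -/
noncomputable def phaseElt (d : ℕ) {n : ℕ} [NeZero d] (i : Fin n) : cliffordGroup d n :=
  ⟨⟨phaseGate d n i, Matrix.mem_unitaryGroup_iff.mpr (by
    rw [phaseGate_eq, star_onQudit, onQudit_mul, Matrix.star_eq_conjTranspose,
      Matrix.diagonal_conjTranspose, Matrix.diagonal_mul_diagonal, ← onQudit_one i,
      ← Matrix.diagonal_one]
    exact congrArg _ (congrArg _ (funext fun x => phaseFun_mul_star x)))⟩,
    Subgroup.subset_closure (Or.inr (Or.inl ⟨i, rfl⟩))⟩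

/-- The controlled addition from qudit `i` to qudit `j` as an element of the Clifford group. -/
noncomputable def caddElt (d : ℕ) {n : ℕ} [NeZero d] {i j : Fin n} (hij : i ≠ j) :
    cliffordGroup d n :=
  ⟨⟨caddGate d n i j, Matrix.mem_unitaryGroup_iff.mpr (caddGate_mul_star hij)⟩,
    Subgroup.subset_closure (Or.inr (Or.inr ⟨i, j, hij, rfl⟩))⟩

lemma toMat_fourierElt (i : Fin n) : toMat (fourierElt d i) = onQudit i (fourierMat d) :=
  fourierGate_eq i

lemma toMat_phaseElt (i : Fin n) :
    toMat (phaseElt d i) = onQudit i (Matrix.diagonal (phaseFun d)) :=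
  phaseGate_eq i

lemma toMat_caddElt {i j : Fin n} (hij : i ≠ j) :
    toMat (caddElt d hij) = caddGate d n i j := rfl

theorem cliffordGroup_induction {p : cliffordGroup d n → Prop} (one : p 1)
    (mul : ∀ g h, p g → p h → p (g * h)) (inv : ∀ g, p g → p g⁻¹)
    (fourier : ∀ i, p (fourierElt d i)) (phase : ∀ i, p (phaseElt d i))
    (cadd : ∀ (i j : Fin n) (hij : i ≠ j), p (caddElt d hij)) (g : cliffordGroup d n) : p g := by
  obtain ⟨U, hU⟩ := g
  induction hU using Subgroup.closure_induction with
  | mem U hU =>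
    rcases hU with ⟨i, h⟩ | ⟨i, h⟩ | ⟨i, j, hij, h⟩
    · convert fourier i
      exact Subtype.ext (Subtype.ext h)
    · convert phase i
      exact Subtype.ext (Subtype.ext h)
    · convert cadd i j hij
      exact Subtype.ext (Subtype.ext h)
  | one => exact one
  | mul U W hU hW h1 h2 => exact mul ⟨U, hU⟩ ⟨W, hW⟩ h1 h2
  | inv U hU h => exact inv ⟨U, hU⟩ h

end Elements

/-! ### Diagonal gates of quadratic forms -/

section Quad

variable {d n : ℕ} [NeZero d]

/-- The diagonal gate of the quadratic form `x ↦ xᵀ M x`. -/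
noncomputable def quadGate (M : Matrix (Fin n) (Fin n) (ZMod d)) :
    Matrix (Conf d n) (Conf d n) ℂ :=
  Matrix.diagonal fun x => stdAddChar (x ⬝ᵥ M *ᵥ x)

lemma diagQuad_eq_quadGate {q : QuadraticForm (ZMod d) (Conf d n)}
    {M : Matrix (Fin n) (Fin n) (ZMod d)} (h : ∀ x, q x = x ⬝ᵥ M *ᵥ x) :
    diagQuad q = quadGate M := by
  simp only [diagQuad, quadGate, h, omegaPow_eq_stdAddChar]

lemma diagQuad_toQuadraticForm' (M : Matrix (Fin n) (Fin n) (ZMod d)) :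
    diagQuad M.toQuadraticForm' = quadGate M :=
  diagQuad_eq_quadGate fun x => by
    simp [Matrix.toQuadraticForm', Matrix.toLinearMap₂'_apply']

lemma quadGate_zero : quadGate (0 : Matrix (Fin n) (Fin n) (ZMod d)) = 1 := by
  simp [quadGate]

lemma quadGate_add (M N : Matrix (Fin n) (Fin n) (ZMod d)) :
    quadGate (M + N) = quadGate M * quadGate N := by
  simp only [quadGate, Matrix.diagonal_mul_diagonal, Matrix.add_mulVec, dotProduct_add,
    AddChar.map_add_eq_mul]

lemma quadGate_transpose (M : Matrix (Fin n) (Fin n) (ZMod d)) :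
    quadGate Mᵀ = quadGate M := by
  simp only [quadGate, Matrix.mulVec_transpose]
  congr 1
  ext x
  rw [dotProduct_comm, Matrix.dotProduct_mulVec]

lemma quadGate_single (i j : Fin n) (a : ZMod d) :
    quadGate (Matrix.single i j a) =
      Matrix.diagonal fun x : Conf d n => stdAddChar (a * (x i * x j)) := by
  simp only [quadGate, Matrix.single_mulVec]
  congr 1
  ext x
  rw [show Function.update (0 : Conf d n) i (a * x j) = Pi.single i (a * x j) from rfl,
    dotProduct_single]
  congr 1
  ring

lemma quadGate_single_self (i : Fin n) (a : ZMod d) :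
    quadGate (Matrix.single i i a) =
      onQudit i (Matrix.diagonal fun x => stdAddChar (a * x ^ 2)) := by
  rw [quadGate_single, onQudit_diagonal]
  simp only [pow_two]

lemma phaseElt_fourierElt_sq (hd : Odd d) (i : Fin n) :
    toMat (phaseElt d i * (fourierElt d i * fourierElt d i) * phaseElt d i) =
      quadGate (Matrix.single i i 1) * toMat (fourierElt d i * fourierElt d i) := by
  simp only [toMat_mul, toMat_phaseElt, toMat_fourierElt, quadGate_single_self, onQudit_mul,
    phase_fourier_sq_phase hd, one_mul]

lemma caddElt_mul_fourierElt {i j : Fin n} (hij : i ≠ j) :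
    toMat (caddElt d hij * fourierElt d j) =
      toMat (fourierElt d j) * quadGate (Matrix.single i j (-1)) := by
  rw [quadGate_single, toMat_mul, toMat_caddElt]
  simp only [neg_mul, one_mul]
  exact caddGate_mul_fourierGate hij

lemma eq_zero_or_eq_one (x : ZMod 2) : x = 0 ∨ x = 1 := by
  revert x
  decide

lemma phaseFun_two (x : ZMod 2) : phaseFun 2 x = if x = 0 then 1 else Complex.I := by
  rw [phaseFun, if_pos even_two, tau_two]
  rcases eq_zero_or_eq_one x with rfl | rfl
  · simp
  · have : ZMod.val (1 : ZMod 2) = 1 := rfl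
    simp [this]

lemma stdAddChar_two (x : ZMod 2) : stdAddChar x = if x = 0 then 1 else (-1 : ℂ) := by
  rcases eq_zero_or_eq_one x with rfl | rfl
  · simp
  · have h := ZMod.stdAddChar_coe (N := 2) 1
    have h2 : 2 * (Real.pi : ℂ) * Complex.I * ((1 : ℤ) : ℂ) / ((2 : ℕ) : ℂ)
        = Real.pi * Complex.I := by push_cast; ring
    rw [h2, Complex.exp_pi_mul_I, Int.cast_one] at h
    simpa using h

lemma phaseElt_two_mul_self (i : Fin n) :
    toMat (phaseElt 2 i * phaseElt 2 i) = quadGate (Matrix.single i i 1) := by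
  rw [toMat_mul, toMat_phaseElt, onQudit_mul, quadGate_single_self, Matrix.diagonal_mul_diagonal]
  congr 2
  ext x
  rw [phaseFun_two, stdAddChar_two]
  rcases eq_zero_or_eq_one x with rfl | rfl <;> simp

/-- The Clifford group contains every `U_q`. -/
lemma exists_toMat_eq_quadGate (hd : Odd d ∨ d = 2) (M : Matrix (Fin n) (Fin n) (ZMod d)) :
    ∃ g : cliffordGroup d n, toMat g = quadGate M := by
  have hadd : ∀ M N : Matrix (Fin n) (Fin n) (ZMod d),
      (∃ g : cliffordGroup d n, toMat g = quadGate M) →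
      (∃ g : cliffordGroup d n, toMat g = quadGate N) →
      ∃ g : cliffordGroup d n, toMat g = quadGate (M + N) := by
    rintro M N ⟨g, hg⟩ ⟨h, hh⟩
    exact ⟨g * h, by rw [toMat_mul, hg, hh, quadGate_add]⟩
  have hzero : ∃ g : cliffordGroup d n,
      toMat g = quadGate (0 : Matrix (Fin n) (Fin n) (ZMod d)) :=
    ⟨1, by rw [toMat_one, quadGate_zero]⟩
  -- on each matrix unit one coefficient `b` that generates `ℤ_d` is enough
  have hunit : ∀ i j : Fin n, ∃ b : ZMod d, IsUnit b ∧ ∃ g : cliffordGroup d n,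
      toMat g = quadGate (Matrix.single i j b) := by
    intro i j
    by_cases hij : i = j
    · subst hij
      refine ⟨1, isUnit_one, ?_⟩
      rcases hd with hd | rfl
      · refine ⟨phaseElt d i * (fourierElt d i * fourierElt d i) * phaseElt d i *
          (fourierElt d i * fourierElt d i)⁻¹, ?_⟩
        rw [toMat_mul, phaseElt_fourierElt_sq hd, toMat_inv, mul_assoc, toMat_mul_star, mul_one]
      · exact ⟨_, phaseElt_two_mul_self i⟩
    · refine ⟨-1, isUnit_one.neg, (fourierElt d j)⁻¹ * (caddElt d hij * fourierElt d j), ?_⟩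
      rw [toMat_mul, caddElt_mul_fourierElt, ← mul_assoc, ← toMat_mul, inv_mul_cancel, toMat_one,
        one_mul]
  induction M using Matrix.induction_on' with
  | h_zero => exact hzero
  | h_add M N hM hN => exact hadd M N hM hN
  | h_std_basis i j a =>
    obtain ⟨b, hb, hg⟩ := hunit i j
    obtain ⟨c, rfl⟩ : ∃ c, a = c * b := hb.dvd.imp fun c hc => hc.trans (mul_comm b c)
    have : ∀ k : ℕ, ∃ g : cliffordGroup d n,
        toMat g = quadGate (Matrix.single i j ((k : ZMod d) * b)) := by
      intro k
      induction k with
      | zero => simpa using hzero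
      | succ k ih =>
        rw [Nat.cast_succ, add_mul, one_mul, Matrix.single_add]
        exact hadd _ _ ih hg
    simpa using this c.val

end Quad

/-! ### Representations of rank zero -/

section RankZero

lemma matrix_eq_zero_of_rank_eq_zero {d n : ℕ} [Fact d.Prime]
    {B : Matrix (Fin n) (Fin n) (ZMod d)}
    (h : B.rank = 0) : B = 0 := by
  rw [Matrix.rank, Submodule.finrank_eq_zero, LinearMap.range_eq_bot] at h
  rw [← Matrix.toLin'_apply'] at h
  exact (LinearEquiv.map_eq_zero_iff Matrix.toLin').mp h

variable {d n : ℕ} [NeZero d] {V : Type*} [AddCommGroup V] [Module ℂ V]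

lemma sum_stdAddChar_trace (N : Matrix (Fin n) (Fin n) (ZMod d)) :
    ∑ B : Matrix (Fin n) (Fin n) (ZMod d), stdAddChar (N * B).trace =
      if N = 0 then (Fintype.card (Matrix (Fin n) (Fin n) (ZMod d)) : ℂ) else 0 := by
  split_ifs with h
  · simp [h]
  · let ψ : AddChar (Matrix (Fin n) (Fin n) (ZMod d)) ℂ :=
      (stdAddChar (N := d)).compAddMonoidHom
        ((Matrix.traceAddMonoidHom (Fin n) (ZMod d)).comp (AddMonoidHom.mulLeft N))
    refine AddChar.sum_eq_zero_of_ne_one (ψ := ψ) fun hψ => h ?_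
    refine Matrix.ext_iff_trace_mul_left.mpr fun X => ?_
    have h1 : stdAddChar (N * X).trace = (1 : ℂ) := DFunLike.congr_fun hψ X
    rw [Matrix.trace_mul_comm, mul_zero, Matrix.trace_zero]
    exact ZMod.injective_stdAddChar (h1.trans (AddChar.map_zero_eq_one _).symm)

/-- If every weight of `ρ` vanishes then `ρ` is trivial on the gates `U_q`: the Fourier components
`∑_M ω^{-tr(M B)} ρ(U_M)` map into the weight spaces, hence vanish for `B ≠ 0`, and by Fourier
inversion `M ↦ ρ(U_M)` is constant. -/
theorem apply_eq_one_of_rk_eq_zero [Fact d.Prime]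
    (ρ : Representation ℂ (cliffordGroup d n) V) (hρ : rk ρ = 0)
    (u : Matrix (Fin n) (Fin n) (ZMod d) → cliffordGroup d n)
    (hu : ∀ M, toMat (u M) = quadGate M) (N : Matrix (Fin n) (Fin n) (ZMod d)) :
    ρ (u N) = 1 := by
  have hweight : ∀ B, IsWeight ρ B → B = 0 := by
    intro B hB
    refine matrix_eq_zero_of_rank_eq_zero (Nat.le_zero.mp ?_)
    rw [← hρ]
    exact le_csSup ⟨n, by rintro _ ⟨C, -, rfl⟩; exact C.rank_le_width⟩ ⟨B, hB, rfl⟩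
  have u_add : ∀ M M', u (M + M') = u M * u M' := fun M M' =>
    toMat_injective (by rw [toMat_mul, hu, hu, hu, quadGate_add])
  have u_transpose : ∀ M, u Mᵀ = u M := fun M =>
    toMat_injective (by rw [hu, hu, quadGate_transpose])
  have u_zero : u 0 = 1 := toMat_injective (by rw [hu, quadGate_zero, toMat_one])
  set P : Matrix (Fin n) (Fin n) (ZMod d) → Module.End ℂ V := fun B =>
    ∑ M, stdAddChar (-(M * B).trace) • ρ (u M) with hP
  have eigen : ∀ M B, ρ (u M) * P B = stdAddChar (M * B).trace • P B := by
    intro M B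
    simp only [hP]
    rw [Finset.mul_sum, Finset.smul_sum,
      ← Equiv.sum_comp (Equiv.addLeft M) fun M' => stdAddChar (M * B).trace • _]
    refine Finset.sum_congr rfl fun M' _ => ?_
    rw [Equiv.coe_addLeft, mul_smul_comm, ← map_mul, ← u_add, smul_smul,
      ← AddChar.map_add_eq_mul]
    congr 2
    rw [add_mul, Matrix.trace_add]
    ring
  have vanish : ∀ B, B ≠ 0 → P B = 0 := by
    intro B hB
    by_contra hPB
    obtain ⟨v, hv⟩ : ∃ v, P B v ≠ 0 := by
      by_contra! h
      exact hPB (LinearMap.ext h)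
    have hev : ∀ M, ρ (u M) (P B v) = stdAddChar (M * B).trace • P B v := fun M =>
      LinearMap.congr_fun (eigen M B) v
    refine hB (hweight B ⟨P B v, ?_, hv, ?_⟩)
    -- a matrix and its transpose give the same quadratic form, which forces `B` to be symmetric
    · refine Matrix.IsSymm.ext fun i j => ?_
      have h := hev (Matrix.single i j 1)
      rw [← u_transpose, hev, Matrix.transpose_single] at h
      have h2 := ZMod.injective_stdAddChar (smul_left_injective ℂ hv h)
      rw [Matrix.trace_single_mul, Matrix.trace_single_mul, one_smul, one_smul] at h2
      exact h2.symm
    · intro q M hq g hg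
      have : g = u M := toMat_injective (by rw [hg, hu, diagQuad_eq_quadGate hq])
      rw [this, hev, omegaPow_eq_stdAddChar]
  have inversion : ∀ N, P 0 = (Fintype.card (Matrix (Fin n) (Fin n) (ZMod d)) : ℂ) • ρ (u N) := by
    intro N
    have h1 : ∑ B, stdAddChar (N * B).trace • P B = P 0 := by
      rw [Finset.sum_eq_single 0 (fun B _ hB => by rw [vanish B hB, smul_zero]) (by simp)]
      simp
    rw [← h1]
    simp only [hP, Finset.smul_sum]
    rw [Finset.sum_comm, Finset.sum_eq_single N]
    · simp [smul_smul, ← AddChar.map_add_eq_mul, ← Nat.cast_smul_eq_nsmul ℂ]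
    · intro M _ hM
      have h2 : ∀ B, stdAddChar (N * B).trace • stdAddChar (-(M * B).trace) • ρ (u M)
          = stdAddChar ((N - M) * B).trace • ρ (u M) := by
        intro B
        rw [smul_smul, ← AddChar.map_add_eq_mul, sub_mul, Matrix.trace_sub, sub_eq_add_neg]
      rw [Finset.sum_congr rfl fun B _ => h2 B, ← Finset.sum_smul, sum_stdAddChar_trace,
        if_neg (sub_ne_zero.mpr hM.symm), zero_smul]
    · simp
  have hcard : (Fintype.card (Matrix (Fin n) (Fin n) (ZMod d)) : ℂ) ≠ 0 :=
    Nat.cast_ne_zero.mpr Fintype.card_ne_zero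
  have h := (inversion N).symm.trans (inversion 0)
  rw [u_zero, map_one] at h
  exact smul_right_injective _ hcard h

theorem map_eq_one_of_rk_eq_zero [Fact d.Prime] (hd : Odd d ∨ d = 2)
    (ρ : Representation ℂ (cliffordGroup d n) V) (hρ : rk ρ = 0) (g : cliffordGroup d n)
    (M : Matrix (Fin n) (Fin n) (ZMod d)) (hg : toMat g = quadGate M) : ρ g = 1 := by
  choose u hu using exists_toMat_eq_quadGate (n := n) hd
  rw [show g = u M from toMat_injective (hg.trans (hu M).symm)]
  exact apply_eq_one_of_rk_eq_zero ρ hρ u hu M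

theorem rk_trivial [Fact d.Prime] (hd : Odd d ∨ d = 2) :
    rk (Representation.trivial ℂ (cliffordGroup d n) ℂ) = 0 := by
  refine Nat.le_zero.mp (csSup_le' ?_)
  rintro _ ⟨B, ⟨ψ, -, hψ, h⟩, rfl⟩
  have hB : B = 0 := by
    refine Matrix.ext_iff_trace_mul_left.mpr fun M => ?_
    obtain ⟨g, hg⟩ := exists_toMat_eq_quadGate hd M
    have h1 := h M.toQuadraticForm' M
      (fun x => by simp [Matrix.toQuadraticForm', Matrix.toLinearMap₂'_apply']) g
      (hg.trans (diagQuad_toQuadraticForm' M).symm)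
    rw [Representation.trivial_apply, omegaPow_eq_stdAddChar] at h1
    have h2 : stdAddChar (M * B).trace = (1 : ℂ) :=
      smul_left_injective ℂ hψ (h1.symm.trans (one_smul ℂ ψ).symm)
    rw [mul_zero, Matrix.trace_zero]
    exact ZMod.injective_stdAddChar (h2.trans (AddChar.map_zero_eq_one _).symm)
  rw [hB, Matrix.rank_zero]

end RankZero

/-! ### The Clifford group modulo the gates of quadratic forms -/

section Quotient

variable {d n : ℕ} [NeZero d] {H : Type*} [Group H]

lemma map_caddElt_eq_one (φ : cliffordGroup d n →* H)
    (hφ : ∀ g M, toMat g = quadGate M → φ g = 1) {i j : Fin n} (hij : i ≠ j) :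
    φ (caddElt d hij) = 1 := by
  have h : φ ((fourierElt d j)⁻¹ * (caddElt d hij * fourierElt d j)) = 1 := by
    refine hφ _ (Matrix.single i j (-1)) ?_
    rw [toMat_mul, caddElt_mul_fourierElt, ← mul_assoc, ← toMat_mul, inv_mul_cancel, toMat_one,
      one_mul]
  rw [map_mul, map_mul, map_inv, inv_mul_eq_one] at h
  simpa using h

/-- For odd `d` the Clifford group is the normal closure of the gates `U_q`. -/
theorem map_eq_one_of_odd (hd : Odd d) (φ : cliffordGroup d n →* H)
    (hφ : ∀ g M, toMat g = quadGate M → φ g = 1) (g : cliffordGroup d n) : φ g = 1 := by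
  have fourier : ∀ i : Fin n, φ (fourierElt d i) = 1 := by
    intro i
    obtain ⟨q, hq⟩ := exists_toMat_eq_quadGate (.inl hd) (Matrix.single i i (half d))
    obtain ⟨q', hq'⟩ := exists_toMat_eq_quadGate (.inl hd) (Matrix.single i i (-half d))
    have h : fourierElt d i * q' * fourierElt d i = q * fourierElt d i * q := by
      apply toMat_injective
      simp only [toMat_mul, hq, hq', quadGate_single_self, toMat_fourierElt, onQudit_mul,
        fourier_quad_fourier hd]
    simpa [hφ _ _ hq, hφ _ _ hq'] using congrArg φ h
  have phase : ∀ i : Fin n, φ (phaseElt d i) = 1 := by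
    intro i
    obtain ⟨q, hq⟩ := exists_toMat_eq_quadGate (.inl hd) (Matrix.single i i (1 : ZMod d))
    have h : phaseElt d i * (fourierElt d i * fourierElt d i) * phaseElt d i =
        q * (fourierElt d i * fourierElt d i) :=
      toMat_injective (by rw [phaseElt_fourierElt_sq hd, toMat_mul q, hq])
    have h2 : φ (phaseElt d i) ^ 2 = 1 := by
      simpa [hφ _ _ hq, fourier i, pow_two] using congrArg φ h
    have h3 : φ (phaseElt d i) ^ d = 1 := by
      rw [← map_pow]
      have : ∀ k : ℕ, toMat (phaseElt d i ^ k) =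
          onQudit i (Matrix.diagonal fun x => phaseFun d x ^ k) := by
        intro k
        induction k with
        | zero => simp [toMat_one, onQudit_one]
        | succ k ih =>
          rw [pow_succ, toMat_mul, ih, toMat_phaseElt, onQudit_mul,
            Matrix.diagonal_mul_diagonal]
          rfl
      -- `S ^ d = 1 = U_0`
      refine hφ _ 0 ?_
      rw [this, quadGate_zero, ← onQudit_one i, ← Matrix.diagonal_one]
      congr 2
      ext x
      rw [phaseFun_of_odd hd, ← AddChar.map_nsmul_eq_pow, nsmul_eq_mul, ZMod.natCast_self,
        zero_mul, AddChar.map_zero_eq_one]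
    -- the order of the image of the phase gate divides both `2` and the odd number `d`
    have h4 : orderOf (φ (phaseElt d i)) ∣ Nat.gcd 2 d :=
      Nat.dvd_gcd (orderOf_dvd_of_pow_eq_one h2) (orderOf_dvd_of_pow_eq_one h3)
    rw [Nat.coprime_two_left.mpr hd, Nat.dvd_one] at h4
    exact orderOf_eq_one_iff.mp h4
  induction g using cliffordGroup_induction with
  | one => exact map_one φ
  | mul g h hg hh => rw [map_mul, hg, hh, one_mul]
  | inv g hg => rw [map_inv, hg, inv_one]
  | fourier i => exact fourier i
  | phase i => exact phase i
  | cadd i j hij => exact map_caddElt_eq_one φ hφ hij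

lemma sum_zmod_two (f : ZMod 2 → ℂ) : ∑ x, f x = f 0 + f 1 := Fin.sum_univ_two f

lemma fourierMat_two (x y : ZMod 2) :
    fourierMat 2 x y = 1 / (Real.sqrt 2 : ℂ) * if x * y = 0 then 1 else -1 := by
  rw [fourierMat, Matrix.of_apply, stdAddChar_two, fourierPhase, if_pos even_two]
  simp

lemma sqrt_two_mul_self : (Real.sqrt 2 : ℂ) * (Real.sqrt 2 : ℂ) = 2 := by
  simpa using sqrt_mul_sqrt (d := 2)

lemma omega8_eq : omega8 = (1 + Complex.I) / (Real.sqrt 2 : ℂ) := by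
  have h : 2 * (Real.pi : ℂ) * Complex.I / 8 = ((Real.pi / 4 : ℝ) : ℂ) * Complex.I := by
    push_cast; ring
  have hs := sqrt_ne_zero (d := 2)
  rw [Nat.cast_two] at hs
  rw [omega8, h, Complex.exp_mul_I, ← Complex.ofReal_cos, ← Complex.ofReal_sin,
    Real.cos_pi_div_four, Real.sin_pi_div_four]
  push_cast
  field_simp
  linear_combination (1 + Complex.I) * sqrt_two_mul_self

lemma fourierElt_two_mul_self (i : Fin n) : fourierElt 2 i * fourierElt 2 i = 1 := by
  apply toMat_injective
  rw [toMat_mul, toMat_fourierElt, onQudit_mul, toMat_one, ← onQudit_one i]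
  congr 1
  ext x y
  rw [fourierMat_mul_self_apply, Matrix.one_apply, fourierPhase, if_pos even_two, one_pow]
  simp only [CharTwo.add_eq_zero]

/-- The relation `(HS)³ = ω_8` of the Hadamard and phase gates. -/
lemma toMat_fourierElt_phaseElt_cubed (i : Fin n) :
    toMat ((fourierElt 2 i * phaseElt 2 i) ^ 3) = omega8 • 1 := by
  simp only [pow_succ, pow_zero, one_mul, toMat_mul, toMat_fourierElt, toMat_phaseElt,
    onQudit_mul]
  rw [← onQudit_smul_one i]
  congr 1
  ext x y
  simp only [Matrix.mul_apply (M := _ * _), Matrix.mul_diagonal, sum_zmod_two, fourierMat_two,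
    phaseFun_two, Matrix.smul_apply, Matrix.one_apply, omega8_eq]
  simp only [div_eq_mul_inv, one_mul]
  have ha : (Real.sqrt 2 : ℂ)⁻¹ * (Real.sqrt 2 : ℂ)⁻¹ = 1 / 2 := by
    rw [← mul_inv, sqrt_two_mul_self, one_div]
  generalize (Real.sqrt 2 : ℂ)⁻¹ = a at ha ⊢
  have hI := Complex.I_mul_I
  rcases eq_zero_or_eq_one x with rfl | rfl <;> rcases eq_zero_or_eq_one y with rfl | rfl <;>
    simp
  · linear_combination -a ^ 3 * hI + (2 + 2 * Complex.I) * a * ha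
  · linear_combination a ^ 3 * Complex.I * hI
  · linear_combination a ^ 3 * hI
  · linear_combination -a ^ 3 * (2 + Complex.I) * hI + (2 + 2 * Complex.I) * a * ha

/-- The relation `S_i S_j CADD = CZ CADD S_j`, which holds because `x + y - (x ⊕ y) = 2xy` for
bits `x` and `y`. Since `CADD` and `CZ` are trivial modulo the gates `U_q`, it forces the phase gate
to be trivial as well. -/
lemma phase_phase_cadd {i j : Fin n} (hij : i ≠ j) :
    toMat (phaseElt 2 i * phaseElt 2 j * caddElt 2 hij) =
      quadGate (Matrix.single i j 1) * toMat (caddElt 2 hij * phaseElt 2 j) := by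
  simp only [toMat_mul, toMat_phaseElt, toMat_caddElt, quadGate_single, onQudit_diagonal,
    Matrix.diagonal_mul_diagonal]
  ext x y
  rw [Matrix.diagonal_mul, Matrix.diagonal_mul, Matrix.mul_diagonal, caddGate, Matrix.of_apply]
  split_ifs with h
  · subst h
    simp only [Function.update_self, Function.update_of_ne hij, phaseFun_two, stdAddChar_two]
    rcases eq_zero_or_eq_one (y i) with h1 | h1 <;> rcases eq_zero_or_eq_one (y j) with h2 | h2 <;>
      simp [h1, h2, CharTwo.add_self_eq_zero]
  · simp

/-- For `d = 2` the Clifford group modulo the normal closure of the gates `U_q` is generated by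
the image of `ω_8`, and has order at most two. -/
theorem map_eq_one_or_eq_of_two (hn : 2 ≤ n) (φ : cliffordGroup 2 n →* H)
    (hφ : ∀ g M, toMat g = quadGate M → φ g = 1) (z : cliffordGroup 2 n)
    (hz : toMat z = omega8 • 1) :
    φ z * φ z = 1 ∧ ∀ g, φ g = 1 ∨ φ g = φ z := by
  have : Nontrivial (Fin n) := Fin.nontrivial_iff_two_le.mpr hn
  have phase : ∀ i : Fin n, φ (phaseElt 2 i) = 1 := by
    intro i
    obtain ⟨j, hji⟩ := exists_ne i
    obtain ⟨q, hq⟩ := exists_toMat_eq_quadGate (.inr rfl) (Matrix.single i j (1 : ZMod 2))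
    have h : phaseElt 2 i * phaseElt 2 j * caddElt 2 hji.symm =
        q * (caddElt 2 hji.symm * phaseElt 2 j) :=
      toMat_injective (by rw [phase_phase_cadd, toMat_mul q, hq])
    simpa [hφ _ _ hq, map_caddElt_eq_one φ hφ hji.symm] using congrArg φ h
  have fourier_sq : ∀ i : Fin n, φ (fourierElt 2 i) * φ (fourierElt 2 i) = 1 := fun i => by
    rw [← map_mul, fourierElt_two_mul_self, map_one]
  have fourier : ∀ i : Fin n, φ (fourierElt 2 i) = φ z := by
    intro i
    have h : (fourierElt 2 i * phaseElt 2 i) ^ 3 = z :=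
      toMat_injective ((toMat_fourierElt_phaseElt_cubed i).trans hz.symm)
    rw [← h, map_pow, map_mul, phase i, mul_one, pow_succ, pow_two, fourier_sq, one_mul]
  have hz2 : φ z * φ z = 1 := by
    obtain ⟨i, -⟩ := exists_pair_ne (Fin n)
    rw [← fourier i, fourier_sq]
  refine ⟨hz2, fun g => ?_⟩
  induction g using cliffordGroup_induction with
  | one => exact .inl (map_one φ)
  | mul g h hg hh =>
    rw [map_mul]
    rcases hg with hg | hg <;> rcases hh with hh | hh <;> simp [hg, hh, hz2]
  | inv g hg =>
    rw [map_inv]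
    rcases hg with hg | hg
    · simp [hg]
    · rw [hg]
      exact .inr (inv_eq_of_mul_eq_one_left hz2)
  | fourier i => exact .inr (fourier i)
  | phase i => exact .inl (phase i)
  | cadd i j hij => exact .inl (map_caddElt_eq_one φ hφ hij)

end Quotient

/-! ### Representations by scalars -/

section Scalar

variable {G : Type*} [Group G] {V V' : Type*} [AddCommGroup V] [Module ℂ V] [AddCommGroup V']
  [Module ℂ V']

lemma nontrivial_of_isIrreducible (ρ : Representation ℂ G V) (hρ : ρ.IsIrreducible) :
    Nontrivial V := by
  by_contra h
  rw [not_nontrivial_iff_subsingleton] at h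
  obtain ⟨a, b, hab⟩ := hρ.toNontrivial
  exact hab (Subrepresentation.toSubmodule_injective (Subsingleton.elim _ _))

theorem finrank_eq_one_of_forall_eq_smul (ρ : Representation ℂ G V) (hρ : ρ.IsIrreducible)
    (h : ∀ g, ∃ c : ℂ, ρ g = c • 1) : Module.finrank ℂ V = 1 := by
  have := nontrivial_of_isIrreducible ρ hρ
  obtain ⟨v, hv⟩ := exists_ne (0 : V)
  let W : Subrepresentation ρ := ⟨ℂ ∙ v, fun g w hw => by
    obtain ⟨c, hc⟩ := h g
    rw [hc]
    exact Submodule.smul_mem _ c hw⟩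
  have hW : W = ⊤ := (hρ.eq_bot_or_eq_top W).resolve_left fun hW => hv <| by
    have : (ℂ ∙ v) = ⊥ := congrArg Subrepresentation.toSubmodule hW
    exact Submodule.span_singleton_eq_bot.mp this
  refine finrank_eq_one v hv fun w => Submodule.mem_span_singleton.mp ?_
  have : (ℂ ∙ v) = ⊤ := congrArg Subrepresentation.toSubmodule hW
  rw [this]
  trivial

theorem nonempty_equiv_of_eq_smul [FiniteDimensional ℂ V] [FiniteDimensional ℂ V']
    (ρ : Representation ℂ G V) (ρ' : Representation ℂ G V')
    (hV : Module.finrank ℂ V = 1) (hV' : Module.finrank ℂ V' = 1)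
    (h : ∀ g, ∃ c : ℂ, ρ g = c • 1 ∧ ρ' g = c • 1) : Nonempty (ρ.Equiv ρ') := by
  refine ⟨Representation.Equiv.mk (LinearEquiv.ofFinrankEq V V' (hV.trans hV'.symm)) fun g => ?_⟩
  obtain ⟨c, h1, h2⟩ := h g
  ext v
  simp [h1, h2]

lemma exists_eq_smul_of_mem_center [FiniteDimensional ℂ V] (ρ : Representation ℂ G V)
    (hρ : ρ.IsIrreducible) {z : G} (hz : z ∈ Subgroup.center G) : ∃ c : ℂ, ρ z = c • 1 := by
  obtain ⟨c, hc⟩ :=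
    (Representation.IsIrreducible.algebraMap_intertwiningMap_bijective_of_isAlgClosed
      (ρ := ρ)).surjective (Representation.IntertwiningMap.centralMul ρ z
        (Submonoid.mem_center_iff.mpr (Subgroup.mem_center_iff.mp hz)))
  exact ⟨c, congrArg Representation.IntertwiningMap.toLinearMap hc.symm⟩

lemma isIrreducible_trivial : (Representation.trivial ℂ G ℂ).IsIrreducible where
  exists_pair_ne := ⟨⊥, ⊤, fun h => by
    have : (⊥ : Submodule ℂ ℂ) = ⊤ := congrArg Subrepresentation.toSubmodule h
    exact bot_ne_top this⟩
  eq_bot_or_eq_top W := (eq_bot_or_eq_top W.toSubmodule).imp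
    (fun h => Subrepresentation.toSubmodule_injective h)
    (fun h => Subrepresentation.toSubmodule_injective h)

end Scalar

/-! ### Rank zero for qubits -/

section Qubit

variable {n : ℕ} {V V' : Type*} [AddCommGroup V] [Module ℂ V] [AddCommGroup V'] [Module ℂ V']

lemma mem_center_of_toMat_eq_smul_one {d : ℕ} [NeZero d] {z : cliffordGroup d n} {c : ℂ}
    (hz : toMat z = c • 1) : z ∈ Subgroup.center (cliffordGroup d n) :=
  Subgroup.mem_center_iff.mpr fun g => toMat_injective (by
    rw [toMat_mul, toMat_mul, hz, mul_smul_comm, smul_mul_assoc, mul_one, one_mul])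

theorem finrank_eq_one_and_apply_eq_of_two [FiniteDimensional ℂ V] (hn : 2 ≤ n)
    (ρ : Representation ℂ (cliffordGroup 2 n) V) (hρ : ρ.IsIrreducible) (hrk : rk ρ = 0)
    {z : cliffordGroup 2 n} (hz : toMat z = omega8 • 1) :
    Module.finrank ℂ V = 1 ∧ ∀ g, ρ g = 1 ∨ ρ g = -1 := by
  obtain ⟨hz2, h⟩ := map_eq_one_or_eq_of_two hn ρ.toHomUnits
    (fun g M hg => Units.ext (map_eq_one_of_rk_eq_zero (.inr rfl) ρ hrk g M hg)) z hz
  simp only [Units.ext_iff, Units.val_mul, Units.val_one, MonoidHom.coe_toHomUnits] at hz2 h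
  obtain ⟨c, hc⟩ := exists_eq_smul_of_mem_center ρ hρ (mem_center_of_toMat_eq_smul_one hz)
  have := nontrivial_of_isIrreducible ρ hρ
  obtain ⟨v, hv⟩ := exists_ne (0 : V)
  have hc2 : c * c = 1 := by
    have h1 := LinearMap.congr_fun hz2 v
    rw [hc] at h1
    simp only [Module.End.mul_apply, LinearMap.smul_apply, Module.End.one_apply, smul_smul] at h1
    exact smul_left_injective ℂ hv (h1.trans (one_smul ℂ v).symm)
  constructor
  · refine finrank_eq_one_of_forall_eq_smul ρ hρ fun g => ?_
    rcases h g with hg | hg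
    · exact ⟨1, by rw [hg, one_smul]⟩
    · exact ⟨c, hg.trans hc⟩
  · intro g
    rcases h g with hg | hg
    · exact .inl hg
    · rw [hg, hc]
      rcases mul_self_eq_one_iff.mp hc2 with rfl | rfl
      · exact .inl (one_smul ℂ _)
      · exact .inr (neg_one_smul ℂ _)

theorem nonempty_equiv_of_two [FiniteDimensional ℂ V] [FiniteDimensional ℂ V'] (hn : 2 ≤ n)
    (ρ : Representation ℂ (cliffordGroup 2 n) V) (ρ' : Representation ℂ (cliffordGroup 2 n) V')
    (hρ : ρ.IsIrreducible) (hrk : rk ρ = 0) (hρ' : ρ'.IsIrreducible) (hrk' : rk ρ' = 0)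
    {z : cliffordGroup 2 n} (hz : toMat z = omega8 • 1) {c : ℂ} (hc : ρ z = c • 1)
    (hc' : ρ' z = c • 1) : Nonempty (ρ.Equiv ρ') := by
  obtain ⟨-, h⟩ := map_eq_one_or_eq_of_two hn (ρ.toHomUnits.prod ρ'.toHomUnits)
    (fun g M hg => Prod.ext
      (Units.ext (map_eq_one_of_rk_eq_zero (.inr rfl) ρ hrk g M hg))
      (Units.ext (map_eq_one_of_rk_eq_zero (.inr rfl) ρ' hrk' g M hg))) z hz
  simp only [Prod.ext_iff, MonoidHom.prod_apply, Prod.fst_one, Prod.snd_one, Units.ext_iff,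
    Units.val_one, MonoidHom.coe_toHomUnits] at h
  refine nonempty_equiv_of_eq_smul ρ ρ' (finrank_eq_one_and_apply_eq_of_two hn ρ hρ hrk hz).1
    (finrank_eq_one_and_apply_eq_of_two hn ρ' hρ' hrk' hz).1 fun g => ?_
  rcases h g with ⟨h1, h2⟩ | ⟨h1, h2⟩
  · exact ⟨1, by rw [h1, one_smul], by rw [h2, one_smul]⟩
  · exact ⟨c, h1.trans hc, h2.trans hc'⟩

end Qubit

end CliffordRank

theorem mainTheorem6 :
    -- odd `d`: the trivial representation is the unique irrep of rank zero
    (∀ (d n : ℕ) [Fact d.Prime], Odd d →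
      ((Representation.trivial ℂ (CliffordRank.cliffordGroup d n) ℂ).IsIrreducible ∧
        CliffordRank.rk (Representation.trivial ℂ (CliffordRank.cliffordGroup d n) ℂ) = 0) ∧
      ∀ (V : Type*) [AddCommGroup V] [Module ℂ V] [FiniteDimensional ℂ V]
        (ρ : Representation ℂ (CliffordRank.cliffordGroup d n) V),
        ρ.IsIrreducible → CliffordRank.rk ρ = 0 →
          Nonempty (ρ.Equiv (Representation.trivial ℂ (CliffordRank.cliffordGroup d n) ℂ))) ∧
    -- `d = 2` and `n ≥ 3`
    (∀ n : ℕ, 3 ≤ n →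
      -- irreps of rank zero are one-dimensional and `±1`-valued
      (∀ (V : Type*) [AddCommGroup V] [Module ℂ V] [FiniteDimensional ℂ V]
        (ρ : Representation ℂ (CliffordRank.cliffordGroup 2 n) V),
        ρ.IsIrreducible → CliffordRank.rk ρ = 0 →
          Module.finrank ℂ V = 1 ∧ ∀ g, ρ g = 1 ∨ ρ g = -1) ∧
      -- they are determined by their value on the central element `ω_8 1`
      ∃ z : CliffordRank.cliffordGroup 2 n,
        CliffordRank.toMat z = CliffordRank.omega8 • 1 ∧
        z ∈ Subgroup.center (CliffordRank.cliffordGroup 2 n) ∧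
        ∀ (V : Type*) [AddCommGroup V] [Module ℂ V] [FiniteDimensional ℂ V]
          (V' : Type*) [AddCommGroup V'] [Module ℂ V'] [FiniteDimensional ℂ V']
          (ρ : Representation ℂ (CliffordRank.cliffordGroup 2 n) V)
          (ρ' : Representation ℂ (CliffordRank.cliffordGroup 2 n) V'),
          ρ.IsIrreducible → CliffordRank.rk ρ = 0 →
          ρ'.IsIrreducible → CliffordRank.rk ρ' = 0 →
          (∃ c : ℂ, ρ z = c • 1 ∧ ρ' z = c • 1) →
            Nonempty (ρ.Equiv ρ')) := by
  refine ⟨fun d n _ hd => ⟨⟨CliffordRank.isIrreducible_trivial,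
    CliffordRank.rk_trivial (.inl hd)⟩, ?_⟩, fun n hn => ?_⟩
  · intro V _ _ _ ρ hρ hrk
    have h1 : ∀ g, ρ g = 1 := fun g => by
      rw [← MonoidHom.coe_toHomUnits ρ, CliffordRank.map_eq_one_of_odd hd ρ.toHomUnits
        (fun g M hg => Units.ext (CliffordRank.map_eq_one_of_rk_eq_zero (.inl hd) ρ hrk g M hg)) g,
        Units.val_one]
    exact CliffordRank.nonempty_equiv_of_eq_smul ρ _
      (CliffordRank.finrank_eq_one_of_forall_eq_smul ρ hρ fun g => ⟨1, by rw [h1, one_smul]⟩)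
      (Module.finrank_self ℂ) fun g => ⟨1, by rw [h1, one_smul], by rw [one_smul]; rfl⟩
  · let z : CliffordRank.cliffordGroup 2 n :=
      (CliffordRank.fourierElt 2 ⟨0, by omega⟩ * CliffordRank.phaseElt 2 ⟨0, by omega⟩) ^ 3
    have hz : CliffordRank.toMat z = CliffordRank.omega8 • 1 :=
      CliffordRank.toMat_fourierElt_phaseElt_cubed _
    refine ⟨fun V _ _ _ ρ hρ hrk =>
      CliffordRank.finrank_eq_one_and_apply_eq_of_two (by omega) ρ hρ hrk hz,
      z, hz, CliffordRank.mem_center_of_toMat_eq_smul_one hz, ?_⟩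
    rintro V _ _ _ V' _ _ _ ρ ρ' hρ hrk hρ' hrk' ⟨c, hc, hc'⟩
    exact CliffordRank.nonempty_equiv_of_two (by omega) ρ ρ' hρ hrk hρ' hrk' hz hc hc'
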